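/- Let $d_1,\dots,d_m$ be positive integers (the components), $q\ge 1$ an integer, $l\in\mathbb Z$, and put $\bar l=l+\tfrac12\sum_k d_k$. The Sylvester wave $W_q(l)$ is the coefficient of $t^{-1}$ in $$\sum_\rho \frac{\rho^{\,l}\,e^{\bar l t}}{\prod_{k=1}^m\bigl(e^{d_kt/2}-\rho^{-d_k}e^{-d_kt/2}\bigr)}=\sum_\rho\frac{\rho^{\,l}e^{lt}}{\prod_{k=1}^m\bigl(1-\rho^{-d_k}e^{-d_kt}\bigr)},$$ the sum running over the primitive $q$-th roots of unity $\rho$. Let $\alpha_1,\dots,\alpha_\alpha$ be the components divisible by $q$ ($\alpha$ being their number) and $\beta_j$ those not divisible by $q$ (with multiplicity). Then $$W_q(l)=\frac1{\prod_i\alpha_i}\sum_\rho\frac{\rho^{\,l}}{\prod_j(1-\rho^{-\beta_j})}\sum_{r=0}^{\alpha-1}(-1)^r\frac{\bar l^{\,\alpha-1-r}}{(\alpha-1-r)!}\,\Theta_r .$$ Here $\Theta_r$ is the complete homogeneous function expressed in the power sums $\kappa_1,\kappa_2,\dots$, i.e. $\Theta_0=1$ and $r\Theta_r=\sum_{k=1}^r\kappa_k\Theta_{r-k}$,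 with $$\kappa_n=\frac{\Xi_n}{2^n(n-1)!}+\begin{cases}(-1)^{n/2}\,\bar\tau_n,& n\text{ even}\\0,&n\text{ odd}\end{cases},\qquad \bar\tau_{2n}=\frac{2\,\zeta(2n)}{(2\pi)^{2n}}\sum_i\alpha_i^{2n},$$ $$\Xi_1=-\sum_j\beta_j\frac{1+\rho^{\beta_j}}{1-\rho^{\beta_j}},\qquad \Xi_n=2^n\sum_j\beta_j^n\,\frac1{1-\rho^{-\beta_j}(1+\Delta)}\,0^{n-1}\quad(n\ge2),$$ where $\Delta$ is the forward difference operator, $\Delta^k0^m$ is the value at $x=0$ of the $k$-th difference (step 1) of $x^m$, and $\frac1{1-c(1+\Delta)}0^m=\sum_{k=0}^m\frac{c^k}{(1-c)^{k+1}}\Delta^k0^m$. Moreover, for $n\ge2$ and each such $\rho$, $$\Xi_n=(-2)^n\sum_j\frac{\beta_j^n}{1-\rho^{\beta_j}}\sum_{k=1}^{n-1}k!\left\{{n-1\atop k}\right\}\Bigl(\frac{\rho^{\beta_j}}{1-\rho^{\beta_j}}\Bigr)^k=(-2)^n\sum_j\beta_j^n\frac{\rho^{\beta_j}R_{n-1}(\rho^{\beta_j})}{(1-\rho^{\beta_j})^n}=2^n\sum_j\beta_j^n\frac{\rho^{-\beta_j}R_{n-1}(\rho^{-\beta_j})}{(1-\rho^{-\beta_j})^n},$$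 with Stirling numbers of the second kind and the Euler polynomials $R_n(x)=(x-1)^nH_n(x)$, where $\frac{1-x}{e^t-x}=\sum_nH_n(x)\frac{t^n}{n!}$; and, if $\rho=e^{2\pi ip/q}$ with $\gcd(p,q)=1$, then for all $n\ge1$ $$\Xi_n=-\frac{i^n}{\pi^{n-1}}\sum_j\beta_j^n\,\frac{d^{n-1}}{da^{n-1}}\cot\pi a\Big|_{a=\beta_jp/q}.$$ -/

import Mathlib

noncomputable section

namespace Sylvester

/-- The formal exponential `e^{a t}`, as a Laurent series in `t`. -/
def expSeries (a : ℂ) : LaurentSeries ℂ :=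
  ((PowerSeries.rescale a (PowerSeries.exp ℂ) : PowerSeries ℂ) : LaurentSeries ℂ)

/-- The augmented variable `l + ∑ dₖ / 2`. -/
def augmented {m : ℕ} (d : Fin m → ℕ) (l : ℤ) : ℂ :=
  (l : ℂ) + (∑ k, (d k : ℂ)) / 2

/-- The generating function attached to a root of unity `ρ`:
`ρ^l e^{(l + ∑ dₖ/2) t} / ∏ₖ (e^{dₖ t/2} - ρ^{-dₖ} e^{-dₖ t/2})`,
which is the same as `ρ^l e^{l t} / ∏ₖ (1 - ρ^{-dₖ} e^{-dₖ t})`. -/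
def waveGen {m : ℕ} (d : Fin m → ℕ) (ρ : ℂ) (l : ℤ) : LaurentSeries ℂ :=
  HahnSeries.C (ρ ^ l) * expSeries (augmented d l) /
    ∏ k, (expSeries ((d k : ℂ) / 2)
      - HahnSeries.C ((ρ ^ d k)⁻¹) * expSeries (-((d k : ℂ) / 2)))

/-- The Sylvester wave `W_q` of the components `d`, at `l`: the coefficient of `1/t` in the sum
of the generating functions over the primitive `q`-th roots of unity. -/
def wave {m : ℕ} (d : Fin m → ℕ) (q : ℕ) (l : ℤ) : ℂ :=
  (∑ ρ ∈ primitiveRoots q ℂ, waveGen d ρ l).coeff (-1)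

/-- The indices of the components divisible by `q` (the group of the `αᵢ`). -/
def divisible {m : ℕ} (d : Fin m → ℕ) (q : ℕ) : Finset (Fin m) :=
  Finset.univ.filter (fun k => q ∣ d k)

/-- The indices of the components not divisible by `q` (the group of the `βⱼ`). -/
def nondivisible {m : ℕ} (d : Fin m → ℕ) (q : ℕ) : Finset (Fin m) :=
  Finset.univ.filter (fun k => ¬ q ∣ d k)

/-- The difference of zero `Δ^k 0^n`. -/
def diffZero (k n : ℕ) : ℂ :=
  ((fwdDiff (1 : ℕ))^[k] (fun x : ℕ => (x : ℂ) ^ n)) 0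

/-- The value `(1 - c (1 + Δ))⁻¹ 0^n` of the geometric series in the difference operator `Δ`,
`(1 - c (1 + Δ))⁻¹ = ∑ₖ c^k / (1 - c)^(k+1) Δ^k`; the terms `k > n` vanish on `0^n`. -/
def resolventZero (c : ℂ) (n : ℕ) : ℂ :=
  ∑ k ∈ Finset.range (n + 1), c ^ k / (1 - c) ^ (k + 1) * diffZero k n

/-- The quantities `Ξ_n` (`n ≥ 1`) of the root of unity `ρ`, in finite difference form. -/
def Xi {m : ℕ} (d : Fin m → ℕ) (q : ℕ) (ρ : ℂ) (n : ℕ) : ℂ :=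
  if n = 1 then
    -∑ j ∈ nondivisible d q, (d j : ℂ) * ((1 + ρ ^ d j) / (1 - ρ ^ d j))
  else
    2 ^ n * ∑ j ∈ nondivisible d q, (d j : ℂ) ^ n * resolventZero (ρ ^ d j)⁻¹ (n - 1)

/-- Euler's rational functions: `(1 - x) / (e^t - x) = ∑ₙ H_n(x) t^n / n!`. -/
def eulerH (n : ℕ) (x : ℂ) : ℂ :=
  (n.factorial : ℂ) * PowerSeries.coeff n
    (PowerSeries.C (1 - x) * (PowerSeries.exp ℂ - PowerSeries.C x)⁻¹)

/-- The Euler polynomials: the numerators `R_n` in `H_n(x) = R_n(x) / (x - 1)^n`. -/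
def eulerR (n : ℕ) (x : ℂ) : ℂ := (x - 1) ^ n * eulerH n x

/-- The sum of the `n`-th powers of the components divisible by `q`. -/
def powerSum {m : ℕ} (d : Fin m → ℕ) (q : ℕ) (n : ℕ) : ℂ :=
  ∑ i ∈ divisible d q, (d i : ℂ) ^ n

/-- The constants `τ_n = 2 s_n ζ(n) / (2π)^n` (used for even `n ≥ 2`). -/
def tau {m : ℕ} (d : Fin m → ℕ) (q : ℕ) (n : ℕ) : ℂ :=
  2 * powerSum d q n * riemannZeta (n : ℂ) / (2 * (Real.pi : ℂ)) ^ n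

/-- `κ_n` for `n ≥ 1`. -/
def kappa {m : ℕ} (d : Fin m → ℕ) (q : ℕ) (ρ : ℂ) (n : ℕ) : ℂ :=
  Xi d q ρ n / (2 ^ n * ((n - 1).factorial : ℂ))
    + (if Even n then (-1) ^ (n / 2) * tau d q n else 0)

/-- The complete homogeneous functions `Θ_r`, in terms of the power sums `κ_1, κ_2, …`:
`Θ_0 = 1` and `r Θ_r = ∑_{k=1}^{r} κ_k Θ_{r-k}`. -/
def Theta (κ : ℕ → ℂ) : ℕ → ℂ
  | 0 => 1
  | r + 1 => (∑ k : Fin (r + 1), κ (k + 1) * Theta κ (r - k)) / ((r : ℂ) + 1)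

end Sylvester

end

/-!
The pole of the generating function at `t = 0` comes only from the components divisible by `q`:
for a primitive `q`-th root of unity `ρ`, a factor `e^{dt/2} - ρ^{-d} e^{-dt/2}` vanishes at `t = 0`
exactly when `q ∣ d`, and then it is `2 sinh(dt/2) = t · (d + ⋯)`. So the denominator is `t^α U`
with `U` an invertible power series (`prod_waveFactor_eq`), and the wave is the coefficient of
`t^{α-1}` in `ρ^l e^{(l + ∑ dₖ/2) t} U⁻¹`, summed over `ρ`.

The series `U⁻¹` is determined by its constant term and the logarithmic derivative of `U`. If the
latter is `∑ κ_{n+1} (-t)^n`, then `U⁻¹ = U(0)⁻¹ ∑ Θ_r (-t)^r`, because the differential equation is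
the recurrence that defines `Θ` (`coeff_eq_Theta_of_derivative`). The logarithmic derivative is a
sum over the factors (`coeff_waveLogDerivative`):

* a component `α` divisible by `q` gives the Bernoulli series of `(α/2) coth(αt/2) - 1/t`, whose
  coefficients are values of `ζ` at even integers (`derivative_sinhQuotient`,
  `sum_coeff_sinhLogDerivative`);
* any other component `β` gives `β / (1 - c e^{-βt}) - β/2` with `c = ρ^{-β}`
  (`derivative_waveFactor_eq_mul`), and the Taylor coefficients of `1 / (1 - c e^t)` are the values
  `(1 - c (1 + Δ))⁻¹ 0^n / n!`, since `e^t` is the generating function of the shift `1 + Δ`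
  (`one_sub_mul_resolventGen`).

The other forms of `Ξ_n` are rewritings of these coefficients: the Stirling form is
`Δ^k 0^n = k! S(n, k)` after `c ↦ c⁻¹` (`resolventZero_inv`), the Euler form is
`1 / (1 - x⁻¹ e^t) = -x / (e^t - x)`, and the cotangent form holds because `cot πa` is affine in
`1 / (1 - c)` with `c = e^{-2πia}`, and `c d/dc` raises the exponent `n` in the resolvent at `0^n`
(`iteratedDeriv_cot_pi_mul`).
-/

namespace Sylvester

open PowerSeries

/-! ### Exponential series, differences of zero and Stirling numbers -/

/-- The formal exponential `e^{a t}`, as a power series in `t`. -/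
noncomputable def expPS (a : ℂ) : ℂ⟦X⟧ := rescale a (exp ℂ)

lemma coeff_expPS (a : ℂ) (n : ℕ) : coeff n (expPS a) = a ^ n / (n.factorial : ℂ) := by
  simp [expPS, coeff_rescale, coeff_exp, div_eq_mul_inv]

lemma constantCoeff_expPS (a : ℂ) : constantCoeff (expPS a) = 1 := by
  rw [← coeff_zero_eq_constantCoeff_apply, coeff_expPS]; simp

lemma expPS_mul (a b : ℂ) : expPS a * expPS b = expPS (a + b) :=
  exp_mul_exp_eq_exp_add a b

lemma expPS_zero : expPS 0 = 1 := by
  ext n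
  rw [coeff_expPS, coeff_one]
  rcases eq_or_ne n 0 with rfl | hn <;> simp [*]

lemma expPS_one : expPS 1 = exp ℂ := by simp [expPS]

lemma rescale_expPS (a b : ℂ) : rescale b (expPS a) = expPS (a * b) := by
  ext n
  simp only [coeff_rescale, coeff_expPS, mul_pow]
  ring

lemma derivative_expPS (a : ℂ) : d⁄dX ℂ (expPS a) = C a * expPS a := by
  ext n
  have h : ((n : ℂ) + 1) ≠ 0 := by exact_mod_cast n.succ_ne_zero
  have h' : (n.factorial : ℂ) ≠ 0 := by exact_mod_cast n.factorial_ne_zero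
  rw [coeff_derivative, coeff_C_mul, coeff_expPS, coeff_expPS, Nat.factorial_succ]
  push_cast
  field_simp
  ring

/-- Expanding both sides by the binomial theorem, the difference of zero `Δ^k 0^n` is the
exponential Taylor coefficient of `(e^t - 1)^k`. -/
lemma diffZero_eq_coeff (k n : ℕ) :
    diffZero k n = (n.factorial : ℂ) * coeff n ((exp ℂ - 1) ^ k) := by
  have h' : (n.factorial : ℂ) ≠ 0 := by exact_mod_cast n.factorial_ne_zero
  rw [diffZero, fwdDiff_iter_eq_sum_shift, sub_eq_add_neg, add_pow, map_sum, Finset.mul_sum]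
  refine Finset.sum_congr rfl fun i _ => ?_
  have : exp ℂ ^ i * (-1) ^ (k - i) * (k.choose i : ℂ⟦X⟧)
      = C ((-1) ^ (k - i) * (k.choose i : ℂ)) * expPS i := by
    rw [exp_pow_eq_rescale_exp]
    simp only [map_mul, map_pow, map_neg, map_one, map_natCast, expPS]
    ring
  rw [this, coeff_C_mul, coeff_expPS]
  simp only [zero_add, smul_eq_mul, mul_one, zsmul_eq_mul]
  push_cast
  field_simp

lemma diffZero_zero (k : ℕ) : diffZero k 0 = if k = 0 then 1 else 0 := by
  rw [diffZero_eq_coeff]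
  rcases eq_or_ne k 0 with rfl | hk
  · simp
  · simp [hk]

lemma diffZero_zero_succ (n : ℕ) : diffZero 0 (n + 1) = 0 := by
  simp [diffZero_eq_coeff, coeff_one]

/-- Differentiating `(e^t - 1)^(k+1)` gives `(k+1) ((e^t - 1)^(k+1) + (e^t - 1)^k)`. -/
lemma diffZero_succ_succ (k n : ℕ) :
    diffZero (k + 1) (n + 1) = ((k : ℂ) + 1) * (diffZero (k + 1) n + diffZero k n) := by
  have hd : d⁄dX ℂ ((exp ℂ - 1) ^ (k + 1))
      = C ((k : ℂ) + 1) * ((exp ℂ - 1) ^ (k + 1) + (exp ℂ - 1) ^ k) := by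
    rw [derivative_pow, map_sub, derivative_exp, derivative_one]
    simp only [map_add, map_natCast, map_one]
    push_cast
    ring
  have h := congrArg (coeff n) hd
  rw [coeff_derivative, coeff_C_mul, map_add] at h
  rw [diffZero_eq_coeff, diffZero_eq_coeff, diffZero_eq_coeff, Nat.factorial_succ]
  push_cast
  linear_combination (n.factorial : ℂ) * h

lemma diffZero_eq_stirlingSecond (k n : ℕ) :
    diffZero k n = (k.factorial : ℂ) * (Nat.stirlingSecond n k : ℂ) := by
  induction n generalizing k with
  | zero =>
    rw [diffZero_zero]
    cases k <;> simp
  | succ n ih =>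
    cases k with
    | zero => rw [diffZero_zero_succ]; simp
    | succ k =>
      rw [diffZero_succ_succ, ih, ih, Nat.stirlingSecond_succ_succ, Nat.factorial_succ]
      push_cast
      ring

lemma diffZero_eq_zero_of_lt {k n : ℕ} (h : n < k) : diffZero k n = 0 := by
  rw [diffZero_eq_stirlingSecond, Nat.stirlingSecond_eq_zero_of_lt h]; simp

/-! ### The resolvent of the difference operator at zero -/

/-- The exponential generating function of the values `(1 - c (1 + Δ))⁻¹ 0^n`. -/
noncomputable def resolventGen (c : ℂ) : ℂ⟦X⟧ :=
  mk fun n => resolventZero c n / (n.factorial : ℂ)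

/-- The generating function of the resolvent is `1 / (1 - c e^t)`: this is the geometric series
of `(1 - c) - c (e^t - 1)`, and truncating it at `k = n` does not affect the coefficients
up to degree `n`. -/
lemma one_sub_mul_resolventGen {c : ℂ} (hc : c ≠ 1) :
    (1 - C c * exp ℂ) * resolventGen c = 1 := by
  have h1 : 1 - c ≠ 0 := sub_ne_zero.mpr hc.symm
  have hX : (X : ℂ⟦X⟧) ∣ exp ℂ - 1 := by rw [X_dvd_iff]; simp
  ext n
  set S : ℂ⟦X⟧ := ∑ k ∈ Finset.range (n + 1), C (c ^ k / (1 - c) ^ (k + 1)) * (exp ℂ - 1) ^ k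
    with hS
  -- The coefficients up to degree `n` only see the terms `k ≤ n`, as `X ^ k ∣ (e^t - 1) ^ k`.
  have hSG : (X : ℂ⟦X⟧) ^ (n + 1) ∣ resolventGen c - S := by
    rw [X_pow_dvd_iff]
    intro j hj
    have hf : (j.factorial : ℂ) ≠ 0 := by exact_mod_cast j.factorial_ne_zero
    have hco (k : ℕ) : coeff j ((exp ℂ - 1) ^ k) = diffZero k j / (j.factorial : ℂ) := by
      rw [diffZero_eq_coeff]; field_simp
    rw [map_sub, resolventGen, coeff_mk, hS, map_sum, sub_eq_zero, resolventZero, Finset.sum_div]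
    have hsub : Finset.range (j + 1) ⊆ Finset.range (n + 1) :=
      Finset.range_subset_range.mpr (by omega)
    rw [← Finset.sum_subset hsub]
    · refine Finset.sum_congr rfl fun k _ => ?_
      rw [coeff_C_mul, hco]; ring
    · intro k _ hk
      rw [Finset.mem_range, not_lt] at hk
      rw [coeff_C_mul, hco, diffZero_eq_zero_of_lt (by omega)]
      simp
  -- The finite geometric series telescopes.
  have htel : (1 - C c * exp ℂ) * S
      = 1 - C (c ^ (n + 1) / (1 - c) ^ (n + 1)) * (exp ℂ - 1) ^ (n + 1) := by
    have hfac : (1 - C c * exp ℂ : ℂ⟦X⟧) = C (1 - c) - C c * (exp ℂ - 1) := by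
      rw [map_sub, map_one]; ring
    rw [hS, hfac]
    clear hS hSG S
    induction n with
    | zero =>
      rw [zero_add, Finset.sum_range_one, sub_mul]
      simp only [pow_zero, zero_add, pow_one, mul_one]
      rw [← map_mul, mul_one_div_cancel h1, map_one, mul_right_comm, ← map_mul, mul_one_div]
    | succ n ih =>
      rw [Finset.sum_range_succ, mul_add, ih, sub_mul]
      have e1 : C (1 - c) * (C (c ^ (n + 1) / (1 - c) ^ (n + 1 + 1)) * (exp ℂ - 1) ^ (n + 1))
          = C (c ^ (n + 1) / (1 - c) ^ (n + 1)) * (exp ℂ - 1) ^ (n + 1) := by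
        rw [← mul_assoc, ← map_mul]; congr 2; field_simp; ring
      have e2 : C c * (exp ℂ - 1) *
            (C (c ^ (n + 1) / (1 - c) ^ (n + 1 + 1)) * (exp ℂ - 1) ^ (n + 1))
          = C (c ^ (n + 1 + 1) / (1 - c) ^ (n + 1 + 1)) * (exp ℂ - 1) ^ (n + 1 + 1) := by
        rw [mul_mul_mul_comm, ← map_mul, ← pow_succ']; congr 2; ring
      rw [e1, e2]; ring
  have key : (X : ℂ⟦X⟧) ^ (n + 1) ∣ (1 - C c * exp ℂ) * resolventGen c - 1 := by
    have : (1 - C c * exp ℂ) * resolventGen c - 1 = (1 - C c * exp ℂ) * (resolventGen c - S)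
        - C (c ^ (n + 1) / (1 - c) ^ (n + 1)) * (exp ℂ - 1) ^ (n + 1) := by
      rw [mul_sub, htel]; ring
    rw [this]
    exact dvd_sub (hSG.mul_left _) ((pow_dvd_pow_of_dvd hX _).mul_left _)
  have := (X_pow_dvd_iff.mp key) n (Nat.lt_succ_self n)
  rwa [map_sub, sub_eq_zero] at this

/-- The rescaled form of `one_sub_mul_resolventGen`. -/
lemma one_sub_mul_rescale_resolventGen {c : ℂ} (hc : c ≠ 1) (b : ℂ) :
    (1 - C c * expPS b) * rescale b (resolventGen c) = 1 := by
  have h := congrArg (rescale b) (one_sub_mul_resolventGen hc)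
  rw [← expPS_one] at h
  have hC : rescale b (C c : ℂ⟦X⟧) = C c := by
    ext n; rw [coeff_rescale, coeff_C]; split_ifs with hn <;> simp [hn]
  simpa only [map_mul, map_sub, map_one, rescale_expPS, hC, one_mul] using h

/-- The resolvent at `0^n` is the Stirling number form of `(c d/dc)^n 1 / (1 - c)`, so applying
`c d/dc` once more raises `n` by one. -/
lemma hasDerivAt_resolventZero {c : ℂ} (hc : c ≠ 1) (n : ℕ) :
    ∃ r, HasDerivAt (fun x => resolventZero x n) r c ∧ c * r = resolventZero c (n + 1) := by
  have h1 : 1 - c ≠ 0 := sub_ne_zero.mpr hc.symm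
  have hterm (k : ℕ) : HasDerivAt (fun x : ℂ => x ^ k / (1 - x) ^ (k + 1) * diffZero k n)
      (((k * c ^ (k - 1)) * (1 - c) ^ (k + 1) - c ^ k * (((k + 1 : ℕ) : ℂ) * (1 - c) ^ k * (-1)))
        / ((1 - c) ^ (k + 1)) ^ 2 * diffZero k n) c := by
    have ha : HasDerivAt (fun x : ℂ => x ^ k) (k * c ^ (k - 1)) c := hasDerivAt_pow k c
    have hb : HasDerivAt (fun x : ℂ => (1 - x) ^ (k + 1))
        (((k + 1 : ℕ) : ℂ) * (1 - c) ^ k * (-1)) c := by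
      simpa using ((hasDerivAt_id c).const_sub 1).fun_pow (k + 1)
    exact (ha.div hb (pow_ne_zero _ h1)).mul_const _
  refine ⟨_, HasDerivAt.fun_sum (u := Finset.range (n + 1)) fun k _ => hterm k, ?_⟩
  have hk (k : ℕ) : c * (((k * c ^ (k - 1)) * (1 - c) ^ (k + 1)
        - c ^ k * (((k + 1 : ℕ) : ℂ) * (1 - c) ^ k * (-1))) / ((1 - c) ^ (k + 1)) ^ 2
          * diffZero k n)
      = k * (c ^ k / (1 - c) ^ (k + 1)) * diffZero k n
        + ((k : ℂ) + 1) * (c ^ (k + 1) / (1 - c) ^ (k + 2)) * diffZero k n := by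
    cases k with
    | zero => simp; field_simp
    | succ k =>
      simp only [Nat.add_sub_cancel]
      push_cast
      field_simp
      ring
  rw [Finset.mul_sum, Finset.sum_congr rfl fun k _ => hk k, Finset.sum_add_distrib, resolventZero,
    Finset.sum_range_succ' _ (n + 1), diffZero_zero_succ, mul_zero, add_zero]
  have hsh : ∑ k ∈ Finset.range (n + 1), (k : ℂ) * (c ^ k / (1 - c) ^ (k + 1)) * diffZero k n
      = ∑ k ∈ Finset.range (n + 1),
        ((k : ℂ) + 1) * (c ^ (k + 1) / (1 - c) ^ (k + 2)) * diffZero (k + 1) n := by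
    have h := Finset.sum_range_succ'
      (fun k : ℕ => (k : ℂ) * (c ^ k / (1 - c) ^ (k + 1)) * diffZero k n) (n + 1)
    rw [Finset.sum_range_succ, diffZero_eq_zero_of_lt (Nat.lt_succ_self n)] at h
    simpa using h
  -- Both sums now carry `c ^ (k + 1) / (1 - c) ^ (k + 2)`, and the recurrence for `Δ^k 0^n` applies.
  rw [hsh, ← Finset.sum_add_distrib]
  refine Finset.sum_congr rfl fun k _ => ?_
  rw [diffZero_succ_succ]
  ring

/-! ### Stirling, Euler and cotangent forms of the resolvent -/

/-- The inversion rule comes from `1 / (1 - x⁻¹ e^t) + 1 / (1 - x e^{-t}) = 1`. -/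
lemma resolventZero_inv {x : ℂ} (hx0 : x ≠ 0) (hx1 : x ≠ 1) {n : ℕ} (hn : n ≠ 0) :
    resolventZero x⁻¹ n = (-1) ^ (n + 1) * resolventZero x n := by
  have hG := one_sub_mul_resolventGen (c := x⁻¹) (by simpa [inv_eq_one] using hx1)
  have hH := one_sub_mul_rescale_resolventGen hx1 (-1)
  rw [← expPS_one] at hG
  set G := resolventGen x⁻¹
  set H := rescale (-1) (resolventGen x)
  have he : expPS 1 * expPS (-1) = 1 := by rw [expPS_mul, add_neg_cancel, expPS_zero]
  have hC : (C x⁻¹ * C x : ℂ⟦X⟧) = 1 := by rw [← map_mul, inv_mul_cancel₀ hx0, map_one]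
  have hAB : (1 - C x⁻¹ * expPS 1) + (1 - C x * expPS (-1))
      = (1 - C x⁻¹ * expPS 1) * (1 - C x * expPS (-1)) := by
    linear_combination (-(expPS 1 * expPS (-1))) * hC - he
  have hsum : G + H = 1 := by
    linear_combination (G * H) * hAB + (-H + (1 - C x * expPS (-1)) * H) * hG + (1 - G) * hH
  have h := congrArg (coeff n) hsum
  have hf : (n.factorial : ℂ) ≠ 0 := by exact_mod_cast n.factorial_ne_zero
  simp only [G, H, map_add, coeff_rescale, resolventGen, coeff_mk, coeff_one, if_neg hn] at h
  rw [mul_div_assoc', ← add_div, div_eq_zero_iff, or_iff_left hf] at h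
  rw [pow_succ]
  linear_combination h

/-- `1 / (1 - x⁻¹ e^t) = -x / (e^t - x)`. -/
lemma resolventZero_inv_eq_eulerH {x : ℂ} (hx0 : x ≠ 0) (hx1 : x ≠ 1) (n : ℕ) :
    resolventZero x⁻¹ n = -(x / (1 - x)) * eulerH n x := by
  have h1 : 1 - x ≠ 0 := sub_ne_zero.mpr hx1.symm
  have hG := one_sub_mul_resolventGen (c := x⁻¹) (by simpa [inv_eq_one] using hx1)
  have hK : (exp ℂ - C x) * (exp ℂ - C x)⁻¹ = 1 :=
    PowerSeries.mul_inv_cancel _ (by simpa using h1)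
  have hC : (C x * C x⁻¹ : ℂ⟦X⟧) = 1 := by rw [← map_mul, mul_inv_cancel₀ hx0, map_one]
  have hGK : resolventGen x⁻¹ = -C x * (exp ℂ - C x)⁻¹ := by
    linear_combination (-C x * (exp ℂ - C x)⁻¹) * hG - resolventGen x⁻¹ * hK
      - exp ℂ * (exp ℂ - C x)⁻¹ * resolventGen x⁻¹ * hC
  have h := congrArg (coeff n) hGK
  have hf : (n.factorial : ℂ) ≠ 0 := by exact_mod_cast n.factorial_ne_zero
  rw [← map_neg, coeff_C_mul, resolventGen, coeff_mk, div_eq_iff hf] at h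
  rw [eulerH, coeff_C_mul, h]
  field_simp

lemma resolventZero_inv_eq_sum_stirlingSecond {x : ℂ} (hx0 : x ≠ 0) (hx1 : x ≠ 1) {n : ℕ}
    (hn : n ≠ 0) :
    resolventZero x⁻¹ n = (-1) ^ (n + 1) * (1 / (1 - x) *
      ∑ k ∈ Finset.Icc 1 n, (k.factorial : ℂ) * (Nat.stirlingSecond n k : ℂ)
        * (x / (1 - x)) ^ k) := by
  obtain ⟨n, rfl⟩ := Nat.exists_eq_succ_of_ne_zero hn
  have h1 : 1 - x ≠ 0 := sub_ne_zero.mpr hx1.symm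
  rw [resolventZero_inv hx0 hx1 hn, resolventZero, Finset.range_eq_Ico,
    Finset.sum_eq_sum_Ico_succ_bot (Nat.succ_pos _), diffZero_zero_succ, mul_zero, zero_add,
    Finset.mul_sum (Finset.Icc 1 (n + 1))]
  congr 1
  refine Finset.sum_congr rfl fun k _ => ?_
  rw [diffZero_eq_stirlingSecond, div_pow]
  field_simp
  ring

lemma cot_pi_mul_eq_resolventZero (a : ℂ)
    (ha : Complex.exp (-(2 * Real.pi * Complex.I) * a) ≠ 1) :
    Complex.cot (Real.pi * a) = 2 * Complex.I *
      resolventZero (Complex.exp (-(2 * Real.pi * Complex.I) * a)) 0 - Complex.I := by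
  have h1 := sub_ne_zero.mpr ha.symm
  have hinv : Complex.exp (2 * Real.pi * Complex.I * a)
      = (Complex.exp (-(2 * Real.pi * Complex.I) * a))⁻¹ := by
    rw [← Complex.exp_neg]; congr 1; ring
  rw [Complex.cot_pi_eq_exp_ratio, hinv]
  have h0 := Complex.exp_ne_zero (-(2 * Real.pi * Complex.I) * a)
  set c := Complex.exp (-(2 * Real.pi * Complex.I) * a)
  simp only [resolventZero, zero_add, Finset.sum_range_one, pow_zero, pow_one, diffZero_zero,
    if_true]
  have h3 : c - 1 ≠ 0 := sub_ne_zero.mpr ha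
  have h4 : Complex.I * (1 - c⁻¹) = Complex.I * (c - 1) / c := by field_simp
  rw [h4]
  field_simp
  rw [Complex.I_sq]
  ring

/-- Away from the integers `cot πa = 2i / (1 - c) - i` with `c = e^{-2πia}`, and `d/da` acts on
functions of `c` as `-2πi · c d/dc`. -/
lemma iteratedDeriv_cot_pi_mul (n : ℕ) (a : ℂ)
    (ha : Complex.exp (-(2 * Real.pi * Complex.I) * a) ≠ 1) :
    iteratedDeriv n (fun a : ℂ => Complex.cot (Real.pi * a)) a =
      2 * Complex.I * (-(2 * Real.pi * Complex.I)) ^ n *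
        resolventZero (Complex.exp (-(2 * Real.pi * Complex.I) * a)) n
      - if n = 0 then Complex.I else 0 := by
  induction n generalizing a with
  | zero => simpa using cot_pi_mul_eq_resolventZero a ha
  | succ n ih =>
    -- The induction hypothesis holds on a neighbourhood of `a`, so it may be differentiated.
    have hopen : IsOpen {b : ℂ | Complex.exp (-(2 * Real.pi * Complex.I) * b) ≠ 1} :=
      isOpen_ne_fun (by fun_prop) continuous_const
    rw [iteratedDeriv_succ,
      (Filter.eventuallyEq_of_mem (hopen.mem_nhds ha) fun b hb => ih b hb).deriv_eq]
    obtain ⟨r, hr, hcr⟩ := hasDerivAt_resolventZero ha n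
    have hexp : HasDerivAt (fun b : ℂ => Complex.exp (-(2 * Real.pi * Complex.I) * b))
        (Complex.exp (-(2 * Real.pi * Complex.I) * a) * (-(2 * Real.pi * Complex.I))) a := by
      simpa using ((hasDerivAt_id a).const_mul (-(2 * Real.pi * Complex.I))).cexp
    have hcomp := HasDerivAt.comp a hr hexp
    have := ((hcomp.const_mul (2 * Complex.I * (-(2 * Real.pi * Complex.I)) ^ n)).sub_const
      (if n = 0 then Complex.I else 0)).deriv
    simp only [Function.comp_def] at this
    rw [this, ← hcr, if_neg (Nat.succ_ne_zero n), pow_succ]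
    ring

/-! ### Complete homogeneous functions from a logarithmic derivative -/

/-- If `-V' / V = ∑ κ_{n+1} (-t)^n`, then `V = V(0) ∑ Θ_r (-t)^r`: both sides satisfy the same
recurrence. -/
lemma coeff_eq_Theta_of_derivative {V K : ℂ⟦X⟧} {κ : ℕ → ℂ} (hV : d⁄dX ℂ V = -(V * K))
    (hK : ∀ n, coeff n K = (-1) ^ n * κ (n + 1)) (r : ℕ) :
    coeff r V = constantCoeff V * ((-1) ^ r * Theta κ r) := by
  induction r using Nat.strong_induction_on with
  | _ r ih =>
    cases r with
    | zero => simp [Theta]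
    | succ r =>
      have hr : ((r : ℂ) + 1) ≠ 0 := by exact_mod_cast r.succ_ne_zero
      have h := congrArg (coeff r) hV
      rw [coeff_derivative, map_neg, mul_comm V K, coeff_mul,
        Finset.Nat.sum_antidiagonal_eq_sum_range_succ (fun i j => coeff i K * coeff j V)] at h
      have hs : ∑ k ∈ Finset.range (r + 1), coeff k K * coeff (r - k) V
          = constantCoeff V * (-1) ^ r *
            ∑ k ∈ Finset.range (r + 1), κ (k + 1) * Theta κ (r - k) := by
        rw [Finset.mul_sum]
        refine Finset.sum_congr rfl fun k hk => ?_
        have hkr : k ≤ r := Nat.lt_succ_iff.mp (Finset.mem_range.mp hk)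
        rw [hK, ih (r - k) (by omega)]
        have hp : (-1 : ℂ) ^ r = (-1) ^ k * (-1) ^ (r - k) := by
          rw [← pow_add, Nat.add_sub_cancel' hkr]
        rw [hp]; ring
      rw [Nat.succ_eq_add_one, hs] at h
      rw [Theta, Fin.sum_univ_eq_sum_range (fun k => κ (k + 1) * Theta κ (r - k)), pow_succ]
      field_simp
      linear_combination h

lemma derivative_prod_of_logDerivative {ι : Type*} (s : Finset ι) (f g : ι → ℂ⟦X⟧)
    (h : ∀ i ∈ s, d⁄dX ℂ (f i) = f i * g i) :
    d⁄dX ℂ (∏ i ∈ s, f i) = (∏ i ∈ s, f i) * ∑ i ∈ s, g i := by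
  classical
  induction s using Finset.induction_on with
  | empty => simp
  | insert a s ha ih =>
    rw [Finset.prod_insert ha, Finset.sum_insert ha, Derivation.leibniz,
      ih fun i hi => h i (Finset.mem_insert_of_mem hi), h a (Finset.mem_insert_self a s)]
    simp only [smul_eq_mul]
    ring

/-! ### The factors of the generating function -/

/-- The factor `e^{a t/2} - c e^{-a t/2}` of the denominator of the generating function. -/
noncomputable def waveFactor (a c : ℂ) : ℂ⟦X⟧ := expPS (a / 2) - C c * expPS (-(a / 2))

lemma constantCoeff_waveFactor (a c : ℂ) : constantCoeff (waveFactor a c) = 1 - c := by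
  simp [waveFactor, constantCoeff_expPS]

lemma derivative_waveFactor (a c : ℂ) :
    d⁄dX ℂ (waveFactor a c) = C (a / 2) * (expPS (a / 2) + C c * expPS (-(a / 2))) := by
  rw [waveFactor, map_sub, Derivation.leibniz, derivative_expPS, derivative_expPS, derivative_C]
  simp only [smul_eq_mul, map_neg]
  ring

/-- With `P = e^{at/2} - c e^{-at/2}`, the logarithmic derivative is `a e^{at/2} / P - a/2`, and
`e^{at/2} / P = 1 / (1 - c e^{-at})`. -/
lemma derivative_waveFactor_eq_mul (a : ℂ) {c : ℂ} (hc : c ≠ 1) :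
    d⁄dX ℂ (waveFactor a c) =
      waveFactor a c * (C a * rescale (-a) (resolventGen c) - C (a / 2)) := by
  have hG := one_sub_mul_rescale_resolventGen hc (-a)
  have he : expPS (a / 2) * expPS (-a) = expPS (-(a / 2)) := by rw [expPS_mul]; congr 1; ring
  have h2 : (C a : ℂ⟦X⟧) = C (a / 2) + C (a / 2) := by rw [← map_add, add_halves]
  rw [derivative_waveFactor, waveFactor, h2]
  linear_combination (-(2 * C (a / 2) * expPS (a / 2))) * hG
    - 2 * C (a / 2) * C c * rescale (-a) (resolventGen c) * he

/-- The power series `2 sinh(a t/2) / t`. -/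
noncomputable def sinhQuotient (a : ℂ) : ℂ⟦X⟧ := mk fun n => coeff (n + 1) (waveFactor a 1)

lemma X_mul_sinhQuotient (a : ℂ) : X * sinhQuotient a = waveFactor a 1 := by
  ext n
  cases n with
  | zero =>
    rw [coeff_zero_eq_constantCoeff_apply, coeff_zero_eq_constantCoeff_apply,
      constantCoeff_waveFactor]
    simp
  | succ n => rw [coeff_succ_X_mul, sinhQuotient, coeff_mk]

lemma constantCoeff_sinhQuotient (a : ℂ) : constantCoeff (sinhQuotient a) = a := by
  rw [← coeff_zero_eq_constantCoeff_apply, sinhQuotient, coeff_mk, waveFactor, map_one, one_mul,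
    map_sub, coeff_expPS, coeff_expPS]
  simp

/-- The logarithmic derivative of `2 sinh(a t/2) / t`: the Bernoulli series without its terms of
degree `0` and `1`, divided by `t`. -/
noncomputable def sinhLogDerivative (a : ℂ) : ℂ⟦X⟧ := mk fun n =>
  a ^ (n + 1) * (bernoulli (n + 1) : ℂ) / ((n + 1).factorial : ℂ) + if n = 0 then a / 2 else 0

lemma X_mul_sinhLogDerivative (a : ℂ) :
    X * sinhLogDerivative a = rescale a (bernoulliPowerSeries ℂ) - 1 + C (a / 2) * X := by
  ext n
  cases n with
  | zero =>
    rw [map_add, map_sub, coeff_rescale, bernoulliPowerSeries, coeff_mk]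
    simp
  | succ n =>
    rw [coeff_succ_X_mul, sinhLogDerivative, coeff_mk]
    simp only [map_add, map_sub, coeff_rescale, bernoulliPowerSeries, coeff_mk, coeff_C_mul,
      coeff_one, coeff_X, Nat.succ_ne_zero, if_false, Nat.add_eq_right]
    split_ifs <;> simp [mul_div_assoc]

lemma derivative_sinhQuotient (a : ℂ) :
    d⁄dX ℂ (sinhQuotient a) = sinhQuotient a * sinhLogDerivative a := by
  -- After multiplication by `t²` both sides are expressed by exponentials and the Bernoulli series.
  have hX2 : (X : ℂ⟦X⟧) ^ 2 ≠ 0 := pow_ne_zero _ X_ne_zero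
  refine mul_left_cancel₀ hX2 ?_
  have hQ := X_mul_sinhQuotient a
  have hL := X_mul_sinhLogDerivative a
  have hd := congrArg (d⁄dX ℂ) hQ
  rw [derivative_waveFactor, Derivation.leibniz, derivative_X] at hd
  simp only [smul_eq_mul, mul_one, map_one, one_mul] at hd
  have hB := congrArg (rescale a) (bernoulliPowerSeries_mul_exp_sub_one ℂ)
  rw [map_mul, map_sub, map_one, rescale_X, ← expPS_one, rescale_expPS, one_mul] at hB
  have he : expPS a * expPS (-(a / 2)) = expPS (a / 2) := by rw [expPS_mul]; congr 1; ring
  have h2 : (C a : ℂ⟦X⟧) = C (a / 2) + C (a / 2) := by rw [← map_add, add_halves]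
  rw [waveFactor, map_one, one_mul] at hQ
  rw [h2] at hB
  have : X ^ 2 * (sinhQuotient a * sinhLogDerivative a)
      = (X * sinhQuotient a) * (X * sinhLogDerivative a) := by ring
  rw [this, hL]
  linear_combination X * hd - (1 + (rescale a (bernoulliPowerSeries ℂ) - 1 + C (a / 2) * X)) * hQ
    - expPS (-(a / 2)) * hB + rescale a (bernoulliPowerSeries ℂ) * he

/-- Euler's evaluation of `ζ` at the positive even integers identifies the `α`-part of `κ_n`
with the Taylor coefficients of the logarithmic derivatives of the `2 sinh(αᵢ t/2) / t`. -/
lemma sum_coeff_sinhLogDerivative {m : ℕ} (d : Fin m → ℕ) (q n : ℕ) :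
    ∑ i ∈ divisible d q, coeff n (sinhLogDerivative (d i : ℂ)) =
      (-1) ^ n * if Even (n + 1) then (-1) ^ ((n + 1) / 2) * tau d q (n + 1) else 0 := by
  simp only [sinhLogDerivative, coeff_mk]
  split_ifs with hn0 he he
  · exact absurd he (by simp [hn0])
  · subst hn0
    simp only [zero_add, pow_one, bernoulli_one, mul_zero]
    refine Finset.sum_eq_zero fun i _ => ?_
    push_cast
    simp
    ring
  · obtain ⟨k, hk⟩ := he
    have hk' : n + 1 = 2 * k := by omega
    have hk0 : k ≠ 0 := by omega
    have hodd : (-1 : ℂ) ^ n = -1 := Odd.neg_one_pow ⟨k - 1, by omega⟩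
    have hpi : (Real.pi : ℂ) ≠ 0 := by exact_mod_cast Real.pi_ne_zero
    have hf : ((2 * k).factorial : ℂ) ≠ 0 := by exact_mod_cast (2 * k).factorial_ne_zero
    have h2 : (2 : ℂ) ^ (2 * k) = 2 * 2 ^ (2 * k - 1) := by
      rw [← pow_succ']; congr 1; omega
    have hs : (-1 : ℂ) ^ k * (-1) ^ k = 1 := by rw [← mul_pow]; simp
    rw [hk', Nat.mul_div_cancel_left k two_pos, tau, powerSum, hodd]
    push_cast
    rw [riemannZeta_two_mul_nat hk0, mul_pow, h2, pow_succ (-1 : ℂ) k]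
    simp only [add_zero]
    rw [← Finset.sum_div, ← Finset.sum_mul]
    field_simp
    linear_combination (-(∑ i ∈ divisible d q, (d i : ℂ) ^ (2 * k)) * (bernoulli (2 * k) : ℂ)) * hs
  · have hb : bernoulli (n + 1) = 0 :=
      bernoulli_eq_zero_of_odd (Nat.not_even_iff_odd.mp he) (by omega)
    simp [hb]

/-! ### The coefficient of `1/t` -/

/-- A Laurent series `t^{-n} g` has residue `0` if `n = 0` (where `n - 1` would truncate), and the
coefficient of `t^{n-1}` in `g` otherwise. -/
lemma coeff_neg_one_of_mul_X_pow {f : LaurentSeries ℂ} {g : ℂ⟦X⟧} {n : ℕ}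
    (h : f * (((X : ℂ⟦X⟧) ^ n : ℂ⟦X⟧) : LaurentSeries ℂ) = (g : LaurentSeries ℂ)) :
    f.coeff (-1) = if n = 0 then 0 else coeff (n - 1) g := by
  have h1 := congrArg (fun x : LaurentSeries ℂ => x.coeff (-1 + (n : ℤ))) h
  simp only [HahnSeries.ofPowerSeries_X_pow, HahnSeries.coeff_mul_single_add, mul_one,
    coeff_coe] at h1
  rw [h1]
  rcases Nat.eq_zero_or_pos n with rfl | hn
  · simp
  · rw [if_neg (by omega), if_neg hn.ne', show (-1 + (n : ℤ)).natAbs = n - 1 by omega]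

/-- The power series of the denominator of the generating function, after removing a factor `t`
for each component divisible by `q`. -/
noncomputable def waveUnit {m : ℕ} (d : Fin m → ℕ) (q : ℕ) (ρ : ℂ) : ℂ⟦X⟧ :=
  (∏ j ∈ nondivisible d q, waveFactor (d j) (ρ ^ d j)⁻¹) *
    ∏ i ∈ divisible d q, sinhQuotient (d i)

/-- The logarithmic derivative of `waveUnit`. -/
noncomputable def waveLogDerivative {m : ℕ} (d : Fin m → ℕ) (q : ℕ) (ρ : ℂ) : ℂ⟦X⟧ :=
  (∑ j ∈ nondivisible d q,
    (C (d j : ℂ) * rescale (-(d j : ℂ)) (resolventGen (ρ ^ d j)⁻¹) - C ((d j : ℂ) / 2))) +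
    ∑ i ∈ divisible d q, sinhLogDerivative (d i)

lemma pow_ne_one_of_mem_nondivisible {m : ℕ} {d : Fin m → ℕ} {q : ℕ} {ρ : ℂ}
    (hρ : IsPrimitiveRoot ρ q) {j : Fin m} (hj : j ∈ nondivisible d q) : ρ ^ d j ≠ 1 := by
  rw [Ne, hρ.pow_eq_one_iff_dvd]
  exact (Finset.mem_filter.mp hj).2

lemma derivative_waveUnit {m : ℕ} (d : Fin m → ℕ) {q : ℕ} {ρ : ℂ} (hρ : IsPrimitiveRoot ρ q) :
    d⁄dX ℂ (waveUnit d q ρ) = waveUnit d q ρ * waveLogDerivative d q ρ := by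
  rw [waveUnit, waveLogDerivative, Derivation.leibniz,
    derivative_prod_of_logDerivative _ _ _ fun j hj => derivative_waveFactor_eq_mul (d j : ℂ)
      (inv_ne_one.mpr (pow_ne_one_of_mem_nondivisible hρ hj)),
    derivative_prod_of_logDerivative _ _ _ fun i _ => derivative_sinhQuotient (d i : ℂ)]
  simp only [smul_eq_mul]
  ring

lemma constantCoeff_waveUnit {m : ℕ} (d : Fin m → ℕ) (q : ℕ) (ρ : ℂ) :
    constantCoeff (waveUnit d q ρ) =
      (∏ j ∈ nondivisible d q, (1 - (ρ ^ d j)⁻¹)) * ∏ i ∈ divisible d q, (d i : ℂ) := by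
  simp only [waveUnit, map_mul, map_prod, constantCoeff_waveFactor, constantCoeff_sinhQuotient]

lemma constantCoeff_waveUnit_ne_zero {m : ℕ} {d : Fin m → ℕ} (hd : ∀ k, 0 < d k) {q : ℕ} {ρ : ℂ}
    (hρ : IsPrimitiveRoot ρ q) : constantCoeff (waveUnit d q ρ) ≠ 0 := by
  rw [constantCoeff_waveUnit]
  refine mul_ne_zero (Finset.prod_ne_zero_iff.mpr fun j hj => sub_ne_zero.mpr ?_)
    (Finset.prod_ne_zero_iff.mpr fun i _ => by exact_mod_cast (hd i).ne')
  exact (inv_ne_one.mpr (pow_ne_one_of_mem_nondivisible hρ hj)).symm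

/-- The `κ_n` are, up to sign, the Taylor coefficients of the logarithmic derivative of
`waveUnit`. -/
lemma coeff_waveLogDerivative {m : ℕ} (d : Fin m → ℕ) {q : ℕ} {ρ : ℂ} (hρ0 : ρ ≠ 0)
    (hρ : IsPrimitiveRoot ρ q) (n : ℕ) :
    coeff n (waveLogDerivative d q ρ) = (-1) ^ n * kappa d q ρ (n + 1) := by
  rw [waveLogDerivative, map_add, map_sum, map_sum, sum_coeff_sinhLogDerivative, kappa, mul_add]
  congr 1
  simp only [map_sub, coeff_C_mul, coeff_rescale, resolventGen, coeff_mk, coeff_C,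
    Nat.add_sub_cancel]
  have h2 : (2 : ℂ) ^ (n + 1) ≠ 0 := pow_ne_zero _ two_ne_zero
  have hf : (n.factorial : ℂ) ≠ 0 := by exact_mod_cast n.factorial_ne_zero
  rcases Nat.eq_zero_or_pos n with rfl | hn
  · rw [Xi, if_pos (zero_add 1), ← Finset.sum_neg_distrib, Finset.sum_div, Finset.mul_sum]
    refine Finset.sum_congr rfl fun j hj => ?_
    have hx1 : 1 - ρ ^ d j ≠ 0 := sub_ne_zero.mpr (pow_ne_one_of_mem_nondivisible hρ hj).symm
    have hx1' : ρ ^ d j - 1 ≠ 0 := sub_ne_zero.mpr (pow_ne_one_of_mem_nondivisible hρ hj)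
    have hx0 : ρ ^ d j ≠ 0 := pow_ne_zero _ hρ0
    have hx : 1 - (ρ ^ d j)⁻¹ = (ρ ^ d j - 1) / ρ ^ d j := by field_simp
    have hy : 1 - ρ ^ d j = -(ρ ^ d j - 1) := by ring
    simp only [resolventZero, zero_add, Finset.sum_range_one, diffZero_zero, if_true, pow_one,
      pow_zero, Nat.factorial_zero, Nat.cast_one, hx, hy]
    field_simp
    ring
  · rw [Xi, if_neg (by omega), Nat.add_sub_cancel, Finset.mul_sum, Finset.sum_div,
      Finset.mul_sum]
    refine Finset.sum_congr rfl fun j _ => ?_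
    rw [if_neg hn.ne', neg_pow, pow_succ]
    field_simp
    ring

/-- Exactly the factors with `q ∣ d k` vanish at `t = 0`, each to first order. -/
lemma prod_waveFactor_eq {m : ℕ} (d : Fin m → ℕ) {q : ℕ} {ρ : ℂ} (hρ : IsPrimitiveRoot ρ q) :
    ∏ k, waveFactor (d k) (ρ ^ d k)⁻¹ = X ^ (divisible d q).card * waveUnit d q ρ := by
  have hdiv : ∏ i ∈ divisible d q, waveFactor (d i) (ρ ^ d i)⁻¹
      = X ^ (divisible d q).card * ∏ i ∈ divisible d q, sinhQuotient (d i) := by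
    rw [← Finset.prod_const, ← Finset.prod_mul_distrib]
    refine Finset.prod_congr rfl fun i hi => ?_
    rw [(hρ.pow_eq_one_iff_dvd _).mpr (Finset.mem_filter.mp hi).2, inv_one, X_mul_sinhQuotient]
  rw [← Finset.prod_filter_mul_prod_filter_not Finset.univ (fun k => q ∣ d k)]
  change (∏ i ∈ divisible d q, _) * (∏ j ∈ nondivisible d q, _) = _
  rw [hdiv, waveUnit]
  ring

lemma waveGen_mul_X_pow {m : ℕ} {d : Fin m → ℕ} (hd : ∀ k, 0 < d k) {q : ℕ} {ρ : ℂ}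
    (hρ : IsPrimitiveRoot ρ q) (l : ℤ) :
    waveGen d ρ l * (((X : ℂ⟦X⟧) ^ (divisible d q).card : ℂ⟦X⟧) : LaurentSeries ℂ) =
      ((C (ρ ^ l) * ((waveUnit d q ρ)⁻¹ * expPS (augmented d l)) : ℂ⟦X⟧) : LaurentSeries ℂ) := by
  have hU := constantCoeff_waveUnit_ne_zero hd hρ
  have hfac (k : Fin m) : expSeries ((d k : ℂ) / 2)
      - HahnSeries.C ((ρ ^ d k)⁻¹) * expSeries (-((d k : ℂ) / 2))
      = ((waveFactor (d k) (ρ ^ d k)⁻¹ : ℂ⟦X⟧) : LaurentSeries ℂ) := by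
    rw [waveFactor, coe_sub, coe_mul, coe_C]; rfl
  have hprod : ∏ k, (expSeries ((d k : ℂ) / 2)
      - HahnSeries.C ((ρ ^ d k)⁻¹) * expSeries (-((d k : ℂ) / 2)))
      = ((X ^ (divisible d q).card * waveUnit d q ρ : ℂ⟦X⟧) : LaurentSeries ℂ) := by
    rw [← prod_waveFactor_eq d hρ, map_prod]
    exact Finset.prod_congr rfl fun k _ => hfac k
  have hU0 : waveUnit d q ρ ≠ 0 := fun h => hU (by rw [h, map_zero])
  have hne : ((X ^ (divisible d q).card * waveUnit d q ρ : ℂ⟦X⟧) : LaurentSeries ℂ) ≠ 0 := by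
    rw [Ne, ← coe_zero, HahnSeries.ofPowerSeries_injective.eq_iff]
    exact mul_ne_zero (pow_ne_zero _ X_ne_zero) hU0
  rw [waveGen, hprod, div_mul_eq_mul_div, div_eq_iff hne]
  change HahnSeries.C (ρ ^ l) * ((expPS (augmented d l) : ℂ⟦X⟧) : LaurentSeries ℂ) * _ = _
  rw [← coe_C, ← coe_mul, ← coe_mul, ← coe_mul]
  congr 1
  linear_combination (-(C (ρ ^ l) * expPS (augmented d l) * X ^ (divisible d q).card))
    * PowerSeries.inv_mul_cancel _ hU

/-- The contribution of a single root of unity to the wave. -/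
lemma coeff_waveGen {m : ℕ} {d : Fin m → ℕ} (hd : ∀ k, 0 < d k) {q : ℕ} {ρ : ℂ} (hρ0 : ρ ≠ 0)
    (hρ : IsPrimitiveRoot ρ q) (l : ℤ) :
    (waveGen d ρ l).coeff (-1) = 1 / (∏ i ∈ divisible d q, (d i : ℂ)) *
      (ρ ^ l / (∏ j ∈ nondivisible d q, (1 - (ρ ^ d j)⁻¹)) *
        ∑ r ∈ Finset.range (divisible d q).card,
          (-1) ^ r *
            (augmented d l ^ ((divisible d q).card - 1 - r) /
              (((divisible d q).card - 1 - r).factorial : ℂ)) *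
            Theta (kappa d q ρ) r) := by
  rw [coeff_neg_one_of_mul_X_pow (waveGen_mul_X_pow hd hρ l)]
  split_ifs with h0
  · simp [h0]
  have hU := constantCoeff_waveUnit_ne_zero hd hρ
  have hV : d⁄dX ℂ (waveUnit d q ρ)⁻¹ = -((waveUnit d q ρ)⁻¹ * waveLogDerivative d q ρ) := by
    rw [derivative_inv', derivative_waveUnit d hρ]
    linear_combination (-(waveUnit d q ρ)⁻¹ * waveLogDerivative d q ρ)
      * PowerSeries.inv_mul_cancel _ hU
  have hT := coeff_eq_Theta_of_derivative hV (coeff_waveLogDerivative d hρ0 hρ)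
  rw [coeff_C_mul, coeff_mul, Finset.Nat.sum_antidiagonal_eq_sum_range_succ
    (fun i j => coeff i (waveUnit d q ρ)⁻¹ * coeff j (expPS (augmented d l))),
    Nat.succ_eq_add_one, Nat.sub_add_cancel (Nat.pos_of_ne_zero h0), Finset.mul_sum,
    Finset.mul_sum, Finset.mul_sum]
  refine Finset.sum_congr rfl fun r _ => ?_
  rw [hT, coeff_expPS, constantCoeff_inv, constantCoeff_waveUnit, mul_inv]
  ring

/-! ### The explicit forms of `Ξ_n` at a root of unity -/

/-- The sign comes out as `i^{n+1} · i · (-2πi)^n = -(2π)^n`, for the derivative of order `n`. -/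
lemma Xi_eq_cot {m : ℕ} (d : Fin m → ℕ) {q : ℕ} (hq : 0 < q) {p : ℤ} (hp : IsCoprime p (q : ℤ))
    {n : ℕ} (hn : 1 ≤ n) :
    Xi d q (Complex.exp (2 * Real.pi * Complex.I * p / q)) n =
      -(Complex.I ^ n / (Real.pi : ℂ) ^ (n - 1)) *
        ∑ j ∈ nondivisible d q, (d j : ℂ) ^ n *
          iteratedDeriv (n - 1) (fun a : ℂ => Complex.cot (Real.pi * a))
            ((d j : ℂ) * p / q) := by
  have hρ : IsPrimitiveRoot (Complex.exp (2 * Real.pi * Complex.I * p / q)) q := by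
    have := Complex.isPrimitiveRoot_exp_of_isCoprime p q hq.ne' hp
    rwa [← mul_div_assoc] at this
  obtain ⟨n, rfl⟩ := Nat.exists_eq_add_of_le' hn
  have hpi : (Real.pi : ℂ) ≠ 0 := by exact_mod_cast Real.pi_ne_zero
  set ρ := Complex.exp (2 * Real.pi * Complex.I * p / q) with hρdef
  have hρ0 : ρ ≠ 0 := Complex.exp_ne_zero _
  have hc (j : Fin m) :
      Complex.exp (-(2 * Real.pi * Complex.I) * ((d j : ℂ) * p / q)) = (ρ ^ d j)⁻¹ := by
    rw [hρdef, ← Complex.exp_nat_mul, ← Complex.exp_neg]; congr 1; ring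
  have hcot (j : Fin m) (hj : j ∈ nondivisible d q) :=
    iteratedDeriv_cot_pi_mul n ((d j : ℂ) * p / q)
      (by rw [hc]; exact inv_ne_one.mpr (pow_ne_one_of_mem_nondivisible hρ hj))
  simp only [hc] at hcot
  rw [Nat.add_sub_cancel, Finset.sum_congr rfl fun j hj => by rw [hcot j hj]]
  rcases Nat.eq_zero_or_pos n with rfl | hn0
  · rw [Xi, if_pos (zero_add 1), ← Finset.sum_neg_distrib, Finset.mul_sum]
    refine Finset.sum_congr rfl fun j hj => ?_
    have hx1' : ρ ^ d j - 1 ≠ 0 := sub_ne_zero.mpr (pow_ne_one_of_mem_nondivisible hρ hj)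
    have hx0 : ρ ^ d j ≠ 0 := pow_ne_zero _ hρ0
    have hx : 1 - (ρ ^ d j)⁻¹ = (ρ ^ d j - 1) / ρ ^ d j := by field_simp
    have hy : 1 - ρ ^ d j = -(ρ ^ d j - 1) := by ring
    simp only [resolventZero, zero_add, Finset.sum_range_one, diffZero_zero, if_true, pow_one,
      pow_zero, hx, hy]
    field_simp
    rw [Complex.I_sq]
    ring
  · rw [Xi, if_neg (by omega), Nat.add_sub_cancel, Finset.mul_sum, Finset.mul_sum]
    refine Finset.sum_congr rfl fun j _ => ?_
    have hI : Complex.I ^ n * (-(2 * Real.pi * Complex.I)) ^ n / (Real.pi : ℂ) ^ n = 2 ^ n := by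
      rw [← mul_pow, ← div_pow]
      congr 1
      field_simp
      rw [Complex.I_sq, neg_neg]
    rw [if_neg hn0.ne', sub_zero, pow_succ Complex.I, pow_succ (2 : ℂ)]
    generalize (-(2 * (Real.pi : ℂ) * Complex.I)) ^ n = y at *
    linear_combination
      (2 * Complex.I ^ 2 * (d j : ℂ) ^ (n + 1) * resolventZero (ρ ^ d j)⁻¹ n) * hI
        + (2 * 2 ^ n * (d j : ℂ) ^ (n + 1) * resolventZero (ρ ^ d j)⁻¹ n) * Complex.I_sq

lemma Xi_of_two_le {m : ℕ} (d : Fin m → ℕ) (q : ℕ) (ρ : ℂ) {n : ℕ} (hn : 2 ≤ n) :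
    Xi d q ρ n =
      2 ^ n * ∑ j ∈ nondivisible d q, (d j : ℂ) ^ n * resolventZero (ρ ^ d j)⁻¹ (n - 1) := by
  rw [Xi, if_neg (by omega)]

lemma neg_two_pow_eq (n : ℕ) : (-2 : ℂ) ^ n = 2 ^ n * (-1) ^ n := by
  rw [← mul_pow]; norm_num

lemma neg_one_pow_mul_self (n : ℕ) : (-1 : ℂ) ^ n * (-1) ^ n = 1 := by
  rw [← mul_pow]; simp

lemma eulerR_eq (n : ℕ) (x : ℂ) : eulerR n x = (-1) ^ n * (1 - x) ^ n * eulerH n x := by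
  rw [eulerR, ← mul_pow]; ring

lemma Xi_eq_sum_stirlingSecond {m : ℕ} (d : Fin m → ℕ) {q : ℕ} {ρ : ℂ} (hρ0 : ρ ≠ 0)
    (hρ : IsPrimitiveRoot ρ q) {n : ℕ} (hn : 2 ≤ n) :
    Xi d q ρ n =
      (-2) ^ n * ∑ j ∈ nondivisible d q, (d j : ℂ) ^ n * (1 / (1 - ρ ^ d j)) *
        ∑ k ∈ Finset.Icc 1 (n - 1), (k.factorial : ℂ) * (Nat.stirlingSecond (n - 1) k : ℂ) *
          (ρ ^ d j / (1 - ρ ^ d j)) ^ k := by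
  rw [Xi_of_two_le d q ρ hn, neg_two_pow_eq, mul_assoc, Finset.mul_sum _ _ ((-1 : ℂ) ^ n)]
  congr 1
  refine Finset.sum_congr rfl fun j hj => ?_
  rw [resolventZero_inv_eq_sum_stirlingSecond (pow_ne_zero _ hρ0)
    (pow_ne_one_of_mem_nondivisible hρ hj) (by omega), Nat.sub_add_cancel (by omega)]
  ring

lemma Xi_eq_sum_eulerR {m : ℕ} (d : Fin m → ℕ) {q : ℕ} {ρ : ℂ} (hρ0 : ρ ≠ 0)
    (hρ : IsPrimitiveRoot ρ q) {n : ℕ} (hn : 2 ≤ n) :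
    Xi d q ρ n =
      (-2) ^ n * ∑ j ∈ nondivisible d q, (d j : ℂ) ^ n *
        (ρ ^ d j / (1 - ρ ^ d j) ^ n) * eulerR (n - 1) (ρ ^ d j) := by
  rw [Xi_of_two_le d q ρ hn, neg_two_pow_eq, mul_assoc, Finset.mul_sum _ _ ((-1 : ℂ) ^ n)]
  congr 1
  refine Finset.sum_congr rfl fun j hj => ?_
  obtain ⟨n, rfl⟩ := Nat.exists_eq_add_of_le' (one_le_two.trans hn)
  have h1 := pow_ne_one_of_mem_nondivisible hρ hj
  have h1' := sub_ne_zero.mpr h1.symm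
  have hs := neg_one_pow_mul_self n
  rw [Nat.add_sub_cancel, resolventZero_inv_eq_eulerH (pow_ne_zero _ hρ0) h1, eulerR_eq,
    pow_succ (-1 : ℂ)]
  have hc : ρ ^ d j / (1 - ρ ^ d j) ^ (n + 1) * (1 - ρ ^ d j) ^ n
      = ρ ^ d j / (1 - ρ ^ d j) := by
    rw [pow_succ]; field_simp
  generalize (-1 : ℂ) ^ n = s at *
  linear_combination (s ^ 2 * (d j : ℂ) ^ (n + 1) * eulerH n (ρ ^ d j)) * hc
    + ((d j : ℂ) ^ (n + 1) * (ρ ^ d j / (1 - ρ ^ d j)) * eulerH n (ρ ^ d j)) * hs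

lemma Xi_eq_sum_eulerR_inv {m : ℕ} (d : Fin m → ℕ) {q : ℕ} {ρ : ℂ} (hρ0 : ρ ≠ 0)
    (hρ : IsPrimitiveRoot ρ q) {n : ℕ} (hn : 2 ≤ n) :
    Xi d q ρ n =
      2 ^ n * ∑ j ∈ nondivisible d q, (d j : ℂ) ^ n *
        ((ρ ^ d j)⁻¹ / (1 - (ρ ^ d j)⁻¹) ^ n) * eulerR (n - 1) (ρ ^ d j)⁻¹ := by
  rw [Xi_of_two_le d q ρ hn]
  congr 1
  refine Finset.sum_congr rfl fun j hj => ?_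
  obtain ⟨n, rfl⟩ := Nat.exists_eq_add_of_le' (one_le_two.trans hn)
  have hx0 := inv_ne_zero (pow_ne_zero (d j) hρ0)
  have h1 := inv_ne_one.mpr (pow_ne_one_of_mem_nondivisible hρ hj)
  have h1' := sub_ne_zero.mpr h1.symm
  have ha := resolventZero_inv hx0 h1 (n := n) (by omega)
  rw [resolventZero_inv_eq_eulerH hx0 h1, pow_succ] at ha
  have hb : resolventZero (ρ ^ d j)⁻¹ n
      = (-1) ^ n * ((ρ ^ d j)⁻¹ / (1 - (ρ ^ d j)⁻¹)) * eulerH n (ρ ^ d j)⁻¹ := by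
    linear_combination (-resolventZero (ρ ^ d j)⁻¹ n) * neg_one_pow_mul_self n + (-1) ^ n * ha
  rw [Nat.add_sub_cancel, eulerR_eq, hb]
  generalize (ρ ^ d j)⁻¹ = c at *
  field_simp
  ring

end Sylvester

theorem mainTheorem1 {m : ℕ} (d : Fin m → ℕ) (hd : ∀ k, 0 < d k) (q : ℕ) (hq : 0 < q) :
    (∀ l : ℤ, Sylvester.wave d q l =
      1 / (∏ i ∈ Sylvester.divisible d q, (d i : ℂ)) *
        ∑ ρ ∈ primitiveRoots q ℂ,
          ρ ^ l / (∏ j ∈ Sylvester.nondivisible d q, (1 - (ρ ^ d j)⁻¹)) *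
            ∑ r ∈ Finset.range (Sylvester.divisible d q).card,
              (-1) ^ r *
                (Sylvester.augmented d l ^ ((Sylvester.divisible d q).card - 1 - r) /
                  (((Sylvester.divisible d q).card - 1 - r).factorial : ℂ)) *
                Sylvester.Theta (Sylvester.kappa d q ρ) r) ∧
    (∀ ρ ∈ primitiveRoots q ℂ, ∀ n : ℕ, 2 ≤ n →
      Sylvester.Xi d q ρ n =
        (-2) ^ n * ∑ j ∈ Sylvester.nondivisible d q, (d j : ℂ) ^ n * (1 / (1 - ρ ^ d j)) *
          ∑ k ∈ Finset.Icc 1 (n - 1), (k.factorial : ℂ) * (Nat.stirlingSecond (n - 1) k : ℂ) *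
            (ρ ^ d j / (1 - ρ ^ d j)) ^ k ∧
      Sylvester.Xi d q ρ n =
        (-2) ^ n * ∑ j ∈ Sylvester.nondivisible d q, (d j : ℂ) ^ n *
          (ρ ^ d j / (1 - ρ ^ d j) ^ n) * Sylvester.eulerR (n - 1) (ρ ^ d j) ∧
      Sylvester.Xi d q ρ n =
        2 ^ n * ∑ j ∈ Sylvester.nondivisible d q, (d j : ℂ) ^ n *
          ((ρ ^ d j)⁻¹ / (1 - (ρ ^ d j)⁻¹) ^ n) * Sylvester.eulerR (n - 1) (ρ ^ d j)⁻¹) ∧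
    (∀ p : ℤ, IsCoprime p (q : ℤ) → ∀ n : ℕ, 1 ≤ n →
      Sylvester.Xi d q (Complex.exp (2 * Real.pi * Complex.I * p / q)) n =
        -(Complex.I ^ n / (Real.pi : ℂ) ^ (n - 1)) *
          ∑ j ∈ Sylvester.nondivisible d q, (d j : ℂ) ^ n *
            iteratedDeriv (n - 1) (fun a : ℂ => Complex.cot (Real.pi * a))
              ((d j : ℂ) * p / q)) := by
  refine ⟨fun l => ?_, fun ρ hρ n hn => ?_, fun p hp n hn => Sylvester.Xi_eq_cot d hq hp hn⟩
  · rw [Sylvester.wave, HahnSeries.coeff_sum, Finset.mul_sum]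
    refine Finset.sum_congr rfl fun ρ hρ => ?_
    have hprim := (mem_primitiveRoots hq).mp hρ
    exact Sylvester.coeff_waveGen hd (hprim.ne_zero hq.ne') hprim l
  · have hprim := (mem_primitiveRoots hq).mp hρ
    have hρ0 := hprim.ne_zero hq.ne'
    exact ⟨Sylvester.Xi_eq_sum_stirlingSecond d hρ0 hprim hn,
      Sylvester.Xi_eq_sum_eulerR d hρ0 hprim hn, Sylvester.Xi_eq_sum_eulerR_inv d hρ0 hprim hn⟩
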